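/- Let $G$ be a group acting transitively on a non-empty set $M$, let $m_0 \in M$ have stabiliser $G_0$, and for each $m \in M$ let $g_m \in G$ be such that $g_m m_0 = m$. Put $m \triangleleft gG_0 = g_m g\, m_0$ for $m \in M$ and $gG_0 \in G/G_0$. Identify $n \in M$ with $g_nG_0 \in G/G_0$, so that $m \triangleleft n = g_m n$. Assume the following. - $G_0$ is finite. - (Right amenability.) There is a finitely additive probability measure $\mu$ on the power set of $M$ such that $\mu(A \triangleleft \mathfrak{g}) = \mu(A)$ for all $\mathfrak{g} \in G/G_0$ and all $A \subseteq M$ on which $\cdot \triangleleft \mathfrak{g}$ is injective. - (Finite right generation.) $S \subseteq G/G_0$ is a finite set such that $G_0 S \subseteq S$, such that $g^{-1}G_0 \in S$ whenever $gG_0 \in S$ (symmetry), and such that each $m \in M$ is of the form $((m_0 \triangleleft s_1) \triangleleft s_2) \cdots \triangleleft s_k$ with $k \ge 0$ and $s_1, \dots, s_k \in S$. Let $d$ be the path metric on $M$ of the graph with edges $m \to m \triangleleft s$ ($m \in M$, $s \in S$), and let $B(\kappa) = \{m : d(m_0, m) \le \kappa\}$. Let $H$ be a subgroup of $G$ that contains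 all $g_m$, put $H_0 = H \cap G_0$, and let $Q$ be a finite set. A pattern is a map $p$ from a subset $\operatorname{dom}(p)$ of $M$ to $Q$; a block is a pattern with finite domain. The pattern $p$ semi-occurs in $c \in Q^M$ if there is an $h \in H$ such that $c(hm) = p(m)$ for all $m \in \operatorname{dom}(p)$; it is allowed in $X \subseteq Q^M$ if it semi-occurs in some $x \in X$. A subshift is a set $X \subseteq Q^M$ for which there is a set of blocks such that $X$ consists of all $c \in Q^M$ in which none of these blocks semi-occurs. It is of finite type if this set of blocks can be chosen finite. It is strongly irreducible if there is an integer $\kappa \ge 0$ such that, for all blocks $p, p'$ allowed in $X$ with $d(\operatorname{dom}(p), \operatorname{dom}(p')) \ge \kappa + 1$ (where the distance to the empty set is $\infty$), there is an $x \in X$ that extends both $p$ and $p'$. For a subshift $X$, a map $\Delta : X \to X$ is local if there are an integer $\kappa \ge 0$, a set $N \subseteq B(\kappa)$ with $G_0 N \subseteq N$, and a map $\delta : X_N \to Q$ on the set $X_N = \{x|_N : x \in X\}$ that is invariant under the action $(h_0 p)(n) = p(h_0^{-1} n)$ of $H_0$ on $X_N$, such that $\Delta(x)(m) = \delta(n \mapsto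 x(m \triangleleft n))$ for all $x \in X$ and $m \in M$. It is pre-injective if $x = x'$ whenever $x, x' \in X$ differ in only finitely many cells and $\Delta(x) = \Delta(x')$. Then each strongly irreducible subshift $X \subseteq Q^M$ of finite type has the Moore property (each surjective local map $X \to X$ is pre-injective) and the Myhill property (each pre-injective local map $X \to X$ is surjective). -/

import Mathlib

/-- A coordinate system `(m₀, (g_{m₀,m})_m)` for the action of `G` on `M`.
The group set `(M, G)` together with such a system is a cell space; the existence of a
coordinate system makes `M` non-empty and the action transitive. -/
structure CoordinateSystem (G M : Type*) [Group G] [MulAction G M] where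
  /-- the origin `m₀` -/
  origin : M
  /-- the coordinates `g_{m₀,m}` -/
  coord : M → G
  coord_smul : ∀ m : M, coord m • origin = m

/-- A pattern: a map from a subset `dom` of `M` to `Q`. -/
structure Pattern (M Q : Type*) where
  dom : Set M
  val : dom → Q

namespace Pattern

variable {G M Q : Type*} [Group G] [MulAction G M]

open scoped Pointwise in
/-- The left action of `G` on patterns: `g ▸ p` has domain `g • dom p` and sends `m` to
`p (g⁻¹ • m)`. -/
def translate (g : G) (p : Pattern M Q) : Pattern M Q where
  dom := g • p.dom
  val := fun m => p.val ⟨g⁻¹ • (m : M), Set.mem_smul_set_iff_inv_smul_mem.1 m.2⟩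

/-- A block: a pattern with finite domain. -/
def IsBlock (p : Pattern M Q) : Prop := p.dom.Finite

/-- The pattern `p` coincides with the restriction of the point `c` to the domain of `p`. -/
def AgreesWith (p : Pattern M Q) (c : M → Q) : Prop := ∀ a : p.dom, p.val a = c a

end Pattern

namespace CoordinateSystem

variable {G M Q : Type*} [Group G] [MulAction G M] (K : CoordinateSystem G M)

/-- The stabiliser `G₀` of the origin. -/
abbrev stab : Subgroup G := MulAction.stabilizer G K.origin

/-- The right quotient set semi-action `m ◁ g G₀ = g_{m₀,m} g • m₀` of `G ⧸ G₀` on `M`. -/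
def semiAct (m : M) (q : G ⧸ K.stab) : M :=
  K.coord m • MulAction.ofQuotientStabilizer G K.origin q

theorem semiAct_mk (m : M) (g : G) :
    K.semiAct m (g : G ⧸ K.stab) = (K.coord m * g * (K.coord m)⁻¹) • m := by
  have h : (K.coord m)⁻¹ • m = K.origin := by
    rw [inv_smul_eq_iff, K.coord_smul]
  rw [mul_smul, h, mul_smul]
  rfl

/-- The identification `M → G ⧸ G₀`, `m ↦ G_{m₀,m} = g_{m₀,m} G₀`. -/
def toQuotient (m : M) : G ⧸ K.stab := (K.coord m : G ⧸ K.stab)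

theorem semiAct_toQuotient (m n : M) : K.semiAct m (K.toQuotient n) = K.coord m • n := by
  have h : K.semiAct m (K.toQuotient n) = K.coord m • K.coord n • K.origin := rfl
  rw [h, K.coord_smul]

/-- Right amenability: there is a finitely additive probability measure `μ` on the power set
of `M` that is semi-invariant under the right semi-action. -/
def IsRightAmenable : Prop :=
  ∃ μ : Set M → ℝ,
    (∀ A, 0 ≤ μ A) ∧ μ Set.univ = 1 ∧
    (∀ A B, Disjoint A B → μ (A ∪ B) = μ A + μ B) ∧
    ∀ (q : G ⧸ K.stab) (A : Set M), Set.InjOn (fun m => K.semiAct m q) A →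
      μ ((fun m => K.semiAct m q) '' A) = μ A

/-- `S⁻¹ = {g⁻¹ G₀ | s ∈ S, g ∈ s}`. -/
def inverse (S : Set (G ⧸ K.stab)) : Set (G ⧸ K.stab) :=
  {q | ∃ g : G, (g : G ⧸ K.stab) ∈ S ∧ q = ((g⁻¹ : G) : G ⧸ K.stab)}

/-- `S` is a right generating set: `G₀ · S ⊆ S`, and each cell is of the form
`((m₀ ◁ s₁) ◁ s₂) ⋯ ◁ s_k` with all `s_i` in `S ∪ S⁻¹`. -/
def IsRightGenerating (S : Set (G ⧸ K.stab)) : Prop :=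
  (∀ g ∈ K.stab, ∀ s ∈ S, g • s ∈ S) ∧
  ∀ m : M, ∃ l : List (G ⧸ K.stab),
    (∀ s ∈ l, s ∈ S ∪ K.inverse S) ∧ l.foldl K.semiAct K.origin = m

/-- `S` is symmetric. -/
def IsSymmetric (S : Set (G ⧸ K.stab)) : Prop := K.inverse S ⊆ S

/-- The graph underlying the `S`-Cayley graph: its edges join `m` and `m ◁ s`, for `s ∈ S`.
Loops, labels and multiplicities are dropped, as they do not influence distances; so are
directions, which do not matter for a symmetric set `S` with `G₀ · S ⊆ S`. -/
def cayleyGraph (S : Set (G ⧸ K.stab)) : SimpleGraph M :=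
  SimpleGraph.fromRel fun m m' => ∃ s ∈ S, m' = K.semiAct m s

/-- The `S`-metric. -/
noncomputable def dist (S : Set (G ⧸ K.stab)) (m m' : M) : ℕ∞ := (K.cayleyGraph S).edist m m'

/-- The distance of two sets of cells; it is `⊤` if one of them is empty. -/
noncomputable def setDist (S : Set (G ⧸ K.stab)) (A B : Set M) : ℕ∞ :=
  ⨅ a ∈ A, ⨅ b ∈ B, K.dist S a b

/-- The ball `𝔹(κ)` of radius `κ` centred at the origin. -/
def ball (S : Set (G ⧸ K.stab)) (κ : ℕ) : Set M := {m | K.dist S K.origin m ≤ (κ : ℕ∞)}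

/-- A subgroup is big if it contains all coordinates. -/
def IsBig (H : Subgroup G) : Prop := ∀ m : M, K.coord m ∈ H

/-- The pattern `p` semi-occurs at `m` in the point `c`: some `h ∈ H` with `h • m₀ = m` carries
`p` to a pattern that coincides with the restriction of `c` to `h • dom p`. -/
def SemiOccursAt (H : Subgroup G) (p : Pattern M Q) (m : M) (c : M → Q) : Prop :=
  ∃ h ∈ H, h • K.origin = m ∧ (p.translate h).AgreesWith c

/-- The pattern `p` semi-occurs in the point `c`. -/
def SemiOccurs (H : Subgroup G) (p : Pattern M Q) (c : M → Q) : Prop :=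
  ∃ m : M, K.SemiOccursAt H p m c

/-- The pattern `p` is allowed in `X`. -/
def IsAllowed (H : Subgroup G) (X : Set (M → Q)) (p : Pattern M Q) : Prop :=
  ∃ x ∈ X, K.SemiOccurs H p x

/-- The set of points generated by a set of forbidden patterns. -/
def generated (H : Subgroup G) (F : Set (Pattern M Q)) : Set (M → Q) :=
  {c | ∀ f ∈ F, ¬ K.SemiOccurs H f c}

/-- `X` is a subshift of `Q^M`. -/
def IsSubshift (H : Subgroup G) (X : Set (M → Q)) : Prop :=
  ∃ F : Set (Pattern M Q), (∀ f ∈ F, f.IsBlock) ∧ K.generated H F = X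

/-- `X` is a subshift of finite type. -/
def IsOfFiniteType (H : Subgroup G) (X : Set (M → Q)) : Prop :=
  ∃ F : Set (Pattern M Q), F.Finite ∧ (∀ f ∈ F, f.IsBlock) ∧ K.generated H F = X

/-- `X` is `κ`-strongly irreducible. -/
def IsStronglyIrreducibleWith (S : Set (G ⧸ K.stab)) (H : Subgroup G) (κ : ℕ)
    (X : Set (M → Q)) : Prop :=
  ∀ p p' : Pattern M Q, p.IsBlock → p'.IsBlock → K.IsAllowed H X p → K.IsAllowed H X p' →
    (κ : ℕ∞) + 1 ≤ K.setDist S p.dom p'.dom →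
    ∃ x ∈ X, p.AgreesWith x ∧ p'.AgreesWith x

/-- `X` is strongly irreducible. -/
def IsStronglyIrreducible (S : Set (G ⧸ K.stab)) (H : Subgroup G) (X : Set (M → Q)) : Prop :=
  ∃ κ : ℕ, K.IsStronglyIrreducibleWith S H κ X

/-- The set `X_A` of the restrictions of the points of `X` to `A`. -/
def restrictions (X : Set (M → Q)) (A : Set M) : Set (A → Q) := A.domRestrict '' X

/-- The action of `G₀` on `Q^N`, where `G₀ • N ⊆ N`. -/
def rotate {N : Set M} (hN : ∀ g ∈ K.stab, ∀ n ∈ N, g • n ∈ N) (g : K.stab) (p : N → Q) :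
    N → Q :=
  fun n => p ⟨(g : G)⁻¹ • (n : M), hN _ (inv_mem g.2) _ n.2⟩

/-- The map `Δ : X → Y` is `κ`-local: for some `N ⊆ 𝔹(κ)` with `G₀ • N ⊆ N` and some
`H₀`-invariant map `δ : X_N → Q`, where `H₀ = G₀ ∩ H`, we have
`Δ(x)(m) = δ(n ↦ x(m ◁ n))`. That `n ↦ x(m ◁ n)` belongs to `X_N`, and that `X_N` is stable under
`H₀`, is shown below for subshifts. -/
def IsLocalWith (S : Set (G ⧸ K.stab)) (H : Subgroup G) (κ : ℕ) {X Y : Set (M → Q)}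
    (Δ : X → Y) : Prop :=
  ∃ N : Set M, N ⊆ K.ball S κ ∧ ∃ hN : ∀ g ∈ K.stab, ∀ n ∈ N, g • n ∈ N,
    ∃ δ : restrictions X N → Q,
      (∀ g : K.stab, (g : G) ∈ H → ∀ p p' : restrictions X N,
        (p' : N → Q) = K.rotate hN g p → δ p' = δ p) ∧
      ∀ (x : X) (m : M), ∃ p : restrictions X N,
        (p : N → Q) = (fun n : N => (x : M → Q) (K.semiAct m (K.toQuotient n))) ∧
        (Δ x : M → Q) m = δ p

/-- The map `Δ : X → Y` is local. -/
def IsLocal (S : Set (G ⧸ K.stab)) (H : Subgroup G) {X Y : Set (M → Q)} (Δ : X → Y) : Prop :=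
  ∃ κ : ℕ, K.IsLocalWith S H κ Δ

/-- The set of cells in which two points differ. -/
def difference (c c' : M → Q) : Set M := {m | c m ≠ c' m}

/-- `Δ` is pre-injective. -/
def IsPreInjective {X Y : Set (M → Q)} (Δ : X → Y) : Prop :=
  ∀ x x' : X, (difference (x : M → Q) x').Finite → Δ x = Δ x' → x = x'

/-- The Moore property. -/
def HasMooreProperty (S : Set (G ⧸ K.stab)) (H : Subgroup G) (X : Set (M → Q)) : Prop :=
  ∀ Δ : X → X, K.IsLocal S H Δ → Function.Surjective Δ → IsPreInjective Δ

/-- The Myhill property. -/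
def HasMyhillProperty (S : Set (G ⧸ K.stab)) (H : Subgroup G) (X : Set (M → Q)) : Prop :=
  ∀ Δ : X → X, K.IsLocal S H Δ → IsPreInjective Δ → Function.Surjective Δ

theorem semiOccurs_iff (H : Subgroup G) (p : Pattern M Q) (c : M → Q) :
    K.SemiOccurs H p c ↔ ∃ h ∈ H, ∀ a : p.dom, p.val a = c (h • (a : M)) := by
  constructor
  · rintro ⟨m, h, hH, -, hc⟩
    refine ⟨h, hH, fun a => ?_⟩
    have := hc ⟨h • (a : M), Set.smul_mem_smul_set a.2⟩
    simpa [Pattern.translate] using this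
  · rintro ⟨h, hH, hc⟩
    refine ⟨_, h, hH, rfl, fun a => ?_⟩
    have := hc ⟨h⁻¹ • (a : M), Set.mem_smul_set_iff_inv_smul_mem.1 a.2⟩
    simpa [Pattern.translate] using this

theorem IsSubshift.shift_mem {K : CoordinateSystem G M} {H : Subgroup G} {X : Set (M → Q)}
    (hX : K.IsSubshift H X) {h : G} (hh : h ∈ H) {x : M → Q} (hx : x ∈ X) :
    (fun m => x (h • m)) ∈ X := by
  obtain ⟨F, -, rfl⟩ := hX
  intro f hf hocc
  obtain ⟨k, hk, hkc⟩ := (K.semiOccurs_iff H f _).1 hocc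
  exact hx f hf ((K.semiOccurs_iff H f x).2
    ⟨h * k, mul_mem hh hk, fun a => by rw [hkc a, mul_smul]⟩)

theorem view_mem_restrictions {H : Subgroup G} (hH : K.IsBig H) {X : Set (M → Q)}
    (hX : K.IsSubshift H X) (N : Set M) {x : M → Q} (hx : x ∈ X) (m : M) :
    (fun n : N => x (K.semiAct m (K.toQuotient n))) ∈ restrictions X N :=
  ⟨_, hX.shift_mem (hH m) hx, by funext n; simp [semiAct_toQuotient, Set.domRestrict]⟩

theorem rotate_mem_restrictions {H : Subgroup G} {X : Set (M → Q)} (hX : K.IsSubshift H X)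
    {N : Set M} (hN : ∀ g ∈ K.stab, ∀ n ∈ N, g • n ∈ N) (g : K.stab) (hg : (g : G) ∈ H)
    {p : N → Q} (hp : p ∈ restrictions X N) : K.rotate hN g p ∈ restrictions X N := by
  obtain ⟨x, hx, rfl⟩ := hp
  exact ⟨_, hX.shift_mem (inv_mem hg) hx, rfl⟩

end CoordinateSystem

/-! Both implications come from counting patterns. Fix a finite `E` and `y ∈ X`. Strong
irreducibility makes avoidance of the `E`-pattern of `y` on one translate of `E` cost a factor `1 -
1/C`, with `C` independent of the translate. A finite `F` holds a number of well-separated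
translates proportional to its size, while enlarging `F` to a neighbourhood `A` multiplies the count
by at most `|Q|^|A \ F|`. For a Følner set `F` the loss beats the gain: points avoiding all these
translates have fewer patterns on `A` than `X` has on `F` (`exists_ncard_restrictions_avoiding_lt`).

Myhill: if `Δ` misses `y`, compactness yields a finite `E` such that no image agrees with `y` on
`E`, hence, by equivariance, with a translate of `y` on the translate of `E`. The patterns of `X` on
`F` extend to points that equal `y` far from `F`. Two of them must have images that agree on `A`,
and so everywhere, which contradicts pre-injectivity.

Moore: if `x ≠ x'` differ on a finite set and have the same image, copies of `x` can be erased from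
any point by pasting in `x'` without changing its image (`exists_avoiding_of_eq`). Surjectivity then
makes every pattern on `F` the image of an avoiding pattern on `A`, of which there are too few. -/

namespace CoordinateSystem

variable {G M Q : Type*} [Group G] [MulAction G M] {K : CoordinateSystem G M}
  {S : Set (G ⧸ K.stab)} {H : Subgroup G} {X : Set (M → Q)}

/-! ### The geometry of the Cayley graph -/

theorem smul_semiAct (hS : K.IsRightGenerating S) (g : G) (m : M) {s : G ⧸ K.stab} (hs : s ∈ S) :
    ∃ t ∈ S, g • K.semiAct m s = K.semiAct (g • m) t := by
  -- The factor in front of `s` fixes the origin, so stability of `S` under `G₀` applies. This makes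
  -- the left action isometric.
  refine ⟨((K.coord (g • m))⁻¹ * g * K.coord m) • s, hS.1 _ ?_ s hs, ?_⟩
  · rw [MulAction.mem_stabilizer_iff, mul_smul, mul_smul, K.coord_smul, inv_smul_eq_iff,
      K.coord_smul]
  · simp only [semiAct, MulAction.ofQuotientStabilizer_smul, ← mul_smul]
    congr 1
    group

/-- Every edge can be reversed by an element of `S`, which bounds the undirected degree. Inverting a
representative of `s` is right only up to a change of coordinates lying in `G₀`. -/
theorem exists_eq_semiAct (hS : K.IsRightGenerating S) (hsymm : K.IsSymmetric S) (m : M)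
    {s : G ⧸ K.stab} (hs : s ∈ S) : ∃ t ∈ S, m = K.semiAct (K.semiAct m s) t := by
  obtain ⟨g, rfl⟩ := QuotientGroup.mk_surjective s
  set b := K.semiAct m g with hb
  have hb' : b = (K.coord m * g) • K.origin := by
    rw [hb, mul_smul]; rfl
  refine ⟨((K.coord b)⁻¹ * (K.coord m * g)) • ((g⁻¹ : G) : G ⧸ K.stab),
    hS.1 _ ?_ _ (hsymm ⟨g, hs, rfl⟩), ?_⟩
  · rw [MulAction.mem_stabilizer_iff, mul_smul, ← hb', inv_smul_eq_iff, K.coord_smul]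
  · simp only [semiAct, MulAction.ofQuotientStabilizer_smul, MulAction.ofQuotientStabilizer_mk,
      ← mul_smul]
    rw [show K.coord b * ((K.coord b)⁻¹ * (K.coord m * g) * g⁻¹) = K.coord m by group,
      K.coord_smul]

theorem cayleyGraph_adj_smul (hS : K.IsRightGenerating S) (g : G) {a b : M}
    (h : (K.cayleyGraph S).Adj a b) : (K.cayleyGraph S).Adj (g • a) (g • b) := by
  rw [cayleyGraph, SimpleGraph.fromRel_adj] at h ⊢
  refine ⟨fun he => h.1 (smul_left_cancel g he), h.2.imp ?_ ?_⟩ <;>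
  · rintro ⟨s, hs, rfl⟩
    exact smul_semiAct hS g _ hs

theorem dist_smul_le (hS : K.IsRightGenerating S) (g : G) (a b : M) :
    K.dist S (g • a) (g • b) ≤ K.dist S a b := by
  by_cases h : K.dist S a b = ⊤
  · rw [h]; exact le_top
  · obtain ⟨w, hw⟩ := SimpleGraph.exists_walk_of_edist_ne_top h
    rw [dist, dist, ← hw]
    let φ : K.cayleyGraph S →g K.cayleyGraph S := ⟨(g • ·), cayleyGraph_adj_smul hS g⟩
    exact (SimpleGraph.edist_le (w.map φ)).trans (by rw [SimpleGraph.Walk.length_map])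

theorem dist_smul (hS : K.IsRightGenerating S) (g : G) (a b : M) :
    K.dist S (g • a) (g • b) = K.dist S a b :=
  (dist_smul_le hS g a b).antisymm (by simpa using dist_smul_le hS g⁻¹ (g • a) (g • b))

theorem dist_self (a : M) : K.dist S a a = 0 := SimpleGraph.edist_self

theorem dist_comm (a b : M) : K.dist S a b = K.dist S b a := SimpleGraph.edist_comm

theorem dist_triangle (a b c : M) : K.dist S a c ≤ K.dist S a b + K.dist S b c :=
  SimpleGraph.edist_triangle

theorem dist_le_add {a b c : M} {r s : ℕ} (h : K.dist S a b ≤ r) (h' : K.dist S b c ≤ s) :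
    K.dist S a c ≤ (r + s : ℕ) := by
  push_cast
  exact (dist_triangle a b c).trans (add_le_add h h')

theorem finite_neighborSet (hfin : S.Finite) (hS : K.IsRightGenerating S)
    (hsymm : K.IsSymmetric S) (m : M) : ((K.cayleyGraph S).neighborSet m).Finite := by
  refine (hfin.image (K.semiAct m)).subset fun b hb => ?_
  rw [SimpleGraph.mem_neighborSet, cayleyGraph, SimpleGraph.fromRel_adj] at hb
  obtain ⟨-, ⟨s, hs, rfl⟩ | ⟨s, hs, rfl⟩⟩ := hb
  · exact ⟨s, hs, rfl⟩
  · obtain ⟨t, ht, h⟩ := exists_eq_semiAct hS hsymm b hs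
    exact ⟨t, ht, h.symm⟩

theorem finite_setOf_walk (hfin : S.Finite) (hS : K.IsRightGenerating S)
    (hsymm : K.IsSymmetric S) (n : ℕ) (a : M) :
    {b | ∃ w : (K.cayleyGraph S).Walk a b, w.length = n}.Finite := by
  induction n generalizing a with
  | zero =>
    refine (Set.finite_singleton a).subset ?_
    rintro b ⟨w, hw⟩
    exact (SimpleGraph.Walk.eq_of_length_eq_zero hw).symm
  | succ n ih =>
    refine ((finite_neighborSet hfin hS hsymm a).biUnion fun c _ => ih c).subset ?_
    rintro b ⟨w, hw⟩
    cases w with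
    | nil => simp at hw
    | cons h w => exact Set.mem_biUnion h ⟨w, by simpa using hw⟩

theorem finite_setOf_dist_le (hfin : S.Finite) (hS : K.IsRightGenerating S)
    (hsymm : K.IsSymmetric S) (r : ℕ) (a : M) : {b | K.dist S a b ≤ r}.Finite := by
  refine ((Set.finite_Iic r).biUnion fun n _ => finite_setOf_walk hfin hS hsymm n a).subset ?_
  intro b hb
  obtain ⟨w, hw⟩ := SimpleGraph.exists_walk_of_edist_ne_top
    (ne_top_of_le_ne_top (ENat.natCast_ne_top r) hb)
  refine Set.mem_biUnion (x := w.length) ?_ ⟨w, rfl⟩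
  have : (w.length : ℕ∞) ≤ r := hw.trans_le hb
  exact_mod_cast this

theorem exists_dist_origin_le (hS : K.IsRightGenerating S) (hsymm : K.IsSymmetric S) (m : M) :
    ∃ r : ℕ, K.dist S K.origin m ≤ r := by
  obtain ⟨l, hl, rfl⟩ := hS.2 m
  suffices ∀ a, ∃ r : ℕ, K.dist S a (l.foldl K.semiAct a) ≤ r from this _
  induction l with
  | nil => exact fun a => ⟨0, (dist_self a).le⟩
  | cons s l ih =>
    intro a
    obtain ⟨r, hr⟩ := ih (fun t ht => hl t (List.mem_cons_of_mem s ht)) (K.semiAct a s)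
    refine ⟨1 + r, dist_le_add ?_ hr⟩
    have hs : s ∈ S := (hl s List.mem_cons_self).elim id fun h => hsymm h
    rw [dist, Nat.cast_one, SimpleGraph.edist_le_one_iff_adj_or_eq, cayleyGraph,
      SimpleGraph.fromRel_adj]
    by_cases h : a = K.semiAct a s
    · exact Or.inr h
    · exact Or.inl ⟨h, Or.inl ⟨s, hs, rfl⟩⟩

variable (K S) in
/-- The closed `r`-neighbourhood of a set of cells. -/
def nbhd (r : ℕ) (A : Set M) : Set M := {m | ∃ a ∈ A, K.dist S a m ≤ r}

theorem subset_nbhd (r : ℕ) (A : Set M) : A ⊆ K.nbhd S r A :=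
  fun a ha => ⟨a, ha, by rw [dist_self]; exact zero_le⟩

theorem nbhd_mono {r s : ℕ} (h : r ≤ s) {A B : Set M} (hAB : A ⊆ B) :
    K.nbhd S r A ⊆ K.nbhd S s B :=
  fun _ ⟨a, ha, hm⟩ => ⟨a, hAB ha, hm.trans (by exact_mod_cast h)⟩

theorem nbhd_nbhd_subset (r s : ℕ) (A : Set M) :
    K.nbhd S s (K.nbhd S r A) ⊆ K.nbhd S (r + s) A :=
  fun _ ⟨_, ⟨a, ha, hb⟩, hm⟩ => ⟨a, ha, dist_le_add hb hm⟩

theorem finite_nbhd (hfin : S.Finite) (hS : K.IsRightGenerating S) (hsymm : K.IsSymmetric S)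
    (r : ℕ) {A : Set M} (hA : A.Finite) : (K.nbhd S r A).Finite := by
  refine (hA.biUnion fun a _ => finite_setOf_dist_le hfin hS hsymm r a).subset ?_
  rintro m ⟨a, ha, hm⟩
  exact Set.mem_biUnion ha hm

open scoped Pointwise in
theorem nbhd_smul (hS : K.IsRightGenerating S) (g : G) (r : ℕ) (A : Set M) :
    K.nbhd S r (g • A) = g • K.nbhd S r A := by
  ext m
  rw [Set.mem_smul_set_iff_inv_smul_mem]
  constructor
  · rintro ⟨_, ⟨a, ha, rfl⟩, h⟩
    refine ⟨a, ha, ?_⟩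
    rwa [← dist_smul hS g, smul_inv_smul]
  · rintro ⟨a, ha, h⟩
    refine ⟨g • a, Set.smul_mem_smul_set ha, ?_⟩
    rwa [← dist_smul hS g, smul_inv_smul] at h

theorem exists_subset_ball (hS : K.IsRightGenerating S) (hsymm : K.IsSymmetric S) {A : Set M}
    (hA : A.Finite) : ∃ r : ℕ, A ⊆ K.ball S r := by
  choose f hf using exists_dist_origin_le (S := S) hS hsymm
  obtain ⟨r, hr⟩ := (hA.image f).bddAbove
  exact ⟨r, fun a ha => (hf a).trans (by exact_mod_cast hr ⟨a, ha, rfl⟩)⟩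

theorem dist_coord_smul_le (hS : K.IsRightGenerating S) (t : M) {a : M} {r : ℕ}
    (ha : a ∈ K.ball S r) : K.dist S t (K.coord t • a) ≤ r := by
  have := dist_smul hS (K.coord t) K.origin a
  rw [K.coord_smul] at this
  rw [this]
  exact ha

theorem coord_inv_smul_mem_ball (hS : K.IsRightGenerating S) {t m : M} {r : ℕ}
    (h : K.dist S t m ≤ r) : (K.coord t)⁻¹ • m ∈ K.ball S r := by
  have := dist_smul hS (K.coord t) K.origin ((K.coord t)⁻¹ • m)
  rw [K.coord_smul, smul_inv_smul] at this
  rwa [ball, Set.mem_ofPred_eq, ← this]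

theorem ncard_setOf_dist_le (hS : K.IsRightGenerating S) (r : ℕ) (m : M) :
    {b | K.dist S m b ≤ r}.ncard = (K.ball S r).ncard := by
  refine Eq.trans ?_ (Set.ncard_image_of_injective (K.ball S r)
    (MulAction.injective (K.coord m)))
  congr 1
  ext b
  constructor
  · intro h
    exact ⟨_, coord_inv_smul_mem_ball hS h, smul_inv_smul _ _⟩
  · rintro ⟨a, ha, rfl⟩
    exact dist_coord_smul_le hS m ha

/-! ### Amenability and Følner sets -/

/-- Where `(K.coord m)⁻¹ • f m` takes the value `n`, the map `f` is right translation by `n`. So `f`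
is a finite union of injective translations with disjoint images, each preserving `μ`. -/
theorem measure_range_eq_of_bounded {μ : Set M → ℝ}
    (hadd : ∀ A B : Set M, Disjoint A B → μ (A ∪ B) = μ A + μ B)
    (hinv : ∀ (q : G ⧸ K.stab) (A : Set M), Set.InjOn (fun m => K.semiAct m q) A →
      μ ((fun m => K.semiAct m q) '' A) = μ A)
    {f : M → M} (hf : Function.Injective f)
    (B : Finset M) (hB : ∀ m, (K.coord m)⁻¹ • f m ∈ B) : μ (Set.range f) = μ Set.univ := by
  classical
  have hempty : μ ∅ = 0 := by simpa using hadd ∅ ∅ (by simp)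
  suffices ∀ C : Finset M, μ (f '' {m | (K.coord m)⁻¹ • f m ∈ C}) =
      μ {m | (K.coord m)⁻¹ • f m ∈ C} by
    have h := this B
    have hu : {m | (K.coord m)⁻¹ • f m ∈ B} = Set.univ := Set.eq_univ_of_forall hB
    rwa [hu, Set.image_univ] at h
  intro C
  induction C using Finset.induction_on with
  | empty => simp [hempty]
  | insert n C hn ih =>
    set A₁ : Set M := {m | (K.coord m)⁻¹ • f m = n} with hA₁
    set A₂ : Set M := {m | (K.coord m)⁻¹ • f m ∈ C} with hA₂
    have hU : {m | (K.coord m)⁻¹ • f m ∈ insert n C} = A₁ ∪ A₂ := by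
      ext m; simp [hA₁, hA₂]
    have hdisj : Disjoint A₁ A₂ := by
      rw [Set.disjoint_left]
      intro m (h₁ : _ = n) (h₂ : _ ∈ C)
      exact hn (h₁ ▸ h₂)
    have hEq : Set.EqOn (fun m => K.semiAct m (K.toQuotient n)) f A₁ := by
      intro m (hm : _ = n)
      simp only [semiAct_toQuotient]
      rw [← hm, smul_inv_smul]
    rw [hU, Set.image_union, hadd _ _ ((Set.disjoint_image_iff hf).2 hdisj), hadd _ _ hdisj, ih,
      ← hEq.image_eq, hinv _ _ (hf.injOn.congr hEq.symm)]

/-- Otherwise Hall's marriage theorem gives an injection `M × Bool → M` of displacement at most `r`,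
and `M` contains two disjoint sets of measure one. -/
theorem exists_ncard_nbhd_lt_two_mul (hfin : S.Finite) (hS : K.IsRightGenerating S)
    (hsymm : K.IsSymmetric S) (hamen : K.IsRightAmenable) (r : ℕ) :
    ∃ F : Set M, F.Finite ∧ F.Nonempty ∧ (K.nbhd S r F).ncard < 2 * F.ncard := by
  classical
  by_contra! hcon
  obtain ⟨μ, hpos, huniv, hadd, hinv⟩ := hamen
  let t : M × Bool → Finset M := fun p => (finite_setOf_dist_le hfin hS hsymm r p.1).toFinset
  have hall : ∀ s : Finset (M × Bool), s.card ≤ (s.biUnion t).card := by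
    intro s
    rcases s.eq_empty_or_nonempty with rfl | hs
    · simp
    have h := hcon (s.image Prod.fst : Finset M) (Finset.finite_toSet _) (by simpa using hs)
    have he : K.nbhd S r (s.image Prod.fst : Finset M) = (s.biUnion t : Finset M) := by
      ext m
      simp [nbhd, t]
    rw [he, Set.ncard_coe_finset, Set.ncard_coe_finset] at h
    refine le_trans ?_ h
    calc s.card ≤ ((s.image Prod.fst) ×ˢ (Finset.univ : Finset Bool)).card :=
          Finset.card_le_card fun p hp => by
            rw [Finset.mem_product]
            exact ⟨Finset.mem_image_of_mem _ hp, Finset.mem_univ _⟩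
      _ = 2 * (s.image Prod.fst).card := by
          rw [Finset.card_product, Finset.card_univ, Fintype.card_bool, mul_comm]
  obtain ⟨f, hf, hft⟩ := (Finset.all_card_le_biUnion_card_iff_exists_injective t).1 hall
  have hrange : ∀ b : Bool, μ (Set.range fun m => f (m, b)) = 1 := by
    intro b
    rw [← huniv]
    refine measure_range_eq_of_bounded hadd hinv
      (fun m m' h => congrArg Prod.fst (hf h))
      (finite_setOf_dist_le hfin hS hsymm r K.origin).toFinset fun m => ?_
    have hm := hft (m, b)
    simp only [t, Set.Finite.mem_toFinset, Set.mem_ofPred_eq] at hm ⊢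
    exact coord_inv_smul_mem_ball hS hm
  have hdisj : Disjoint (Set.range fun m => f (m, false)) (Set.range fun m => f (m, true)) := by
    rw [Set.disjoint_left]
    rintro _ ⟨m, rfl⟩ ⟨m', h⟩
    simpa using congrArg Prod.snd (hf h)
  have h₁ := hadd _ _ hdisj
  set R := (Set.range fun m => f (m, false)) ∪ (Set.range fun m => f (m, true))
  have h₂ := hadd R Rᶜ disjoint_compl_right
  rw [Set.union_compl_self, huniv] at h₂
  linarith [hpos Rᶜ, hrange false, hrange true]

/-- Without such a set, each `r`-neighbourhood would grow by a factor `1 + 1/n`. After `n` rounds,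
Bernoulli's inequality gives a factor at least `2` at radius `r * n`, for every finite non-empty
set. -/
theorem exists_folner (hfin : S.Finite) (hS : K.IsRightGenerating S)
    (hsymm : K.IsSymmetric S) (hamen : K.IsRightAmenable) (r n : ℕ) :
    ∃ F : Set M, F.Finite ∧ F.Nonempty ∧ n * (K.nbhd S r F \ F).ncard ≤ F.ncard := by
  by_contra! hcon
  have hgrow : ∀ F : Set M, F.Finite → F.Nonempty →
      (n + 1) * F.ncard ≤ n * (K.nbhd S r F).ncard := by
    intro F hF hne
    have h₁ := hcon F hF hne
    have h₂ := Set.ncard_sdiff_add_ncard_of_subset (subset_nbhd (K := K) (S := S) r F)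
      (finite_nbhd hfin hS hsymm r hF)
    nlinarith
  have hiter : ∀ (j : ℕ) (F : Set M), F.Finite → F.Nonempty →
      (n + 1) ^ j * F.ncard ≤ n ^ j * (K.nbhd S (r * j) F).ncard := by
    intro j
    induction j with
    | zero =>
      intro F hF _
      simpa using Set.ncard_le_ncard (subset_nbhd _ F) (finite_nbhd hfin hS hsymm _ hF)
    | succ j ih =>
      intro F hF hne
      have hF' := finite_nbhd hfin hS hsymm (r * j) hF
      calc (n + 1) ^ (j + 1) * F.ncard = (n + 1) * ((n + 1) ^ j * F.ncard) := by ring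
        _ ≤ (n + 1) * (n ^ j * (K.nbhd S (r * j) F).ncard) := Nat.mul_le_mul_left _ (ih F hF hne)
        _ = n ^ j * ((n + 1) * (K.nbhd S (r * j) F).ncard) := by ring
        _ ≤ n ^ j * (n * (K.nbhd S r (K.nbhd S (r * j) F)).ncard) := by
          gcongr n ^ j * ?_
          exact hgrow _ hF' (hne.mono (subset_nbhd _ F))
        _ ≤ n ^ j * (n * (K.nbhd S (r * (j + 1)) F).ncard) := by
          gcongr
          · exact finite_nbhd hfin hS hsymm _ hF
          · exact nbhd_nbhd_subset _ _ _
        _ = _ := by ring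
  obtain ⟨F, hF, hne, hlt⟩ := exists_ncard_nbhd_lt_two_mul hfin hS hsymm hamen (r * n)
  have hpos : 0 < n := by
    rcases Nat.eq_zero_or_pos n with rfl | h
    · have := hcon F hF hne
      simp at this
    · exact h
  have h₁ := hiter n F hF hne
  -- Bernoulli's inequality with denominators cleared, by induction on the exponent `j`.
  have h₂ : 2 * n ^ n ≤ (n + 1) ^ n := by
    have h : ∀ j : ℕ, n ^ j * (n + j) ≤ n * (n + 1) ^ j := by
      intro j
      induction j with
      | zero => simp
      | succ j ih =>
        calc n ^ (j + 1) * (n + (j + 1 : ℕ)) = n ^ j * (n * (n + j + 1)) := by ring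
          _ ≤ n ^ j * ((n + 1) * (n + j)) := Nat.mul_le_mul_left _ (by nlinarith)
          _ = (n + 1) * (n ^ j * (n + j)) := by ring
          _ ≤ (n + 1) * (n * (n + 1) ^ j) := by gcongr
          _ = _ := by ring
    refine Nat.le_of_mul_le_mul_left ((Eq.le ?_).trans (h n)) hpos
    ring
  have h₃ : 0 < n ^ n := pow_pos hpos n
  nlinarith

open scoped Pointwise

/-! ### Strong irreducibility and counting patterns -/

theorem isAllowed_restriction {x : M → Q} (hx : x ∈ X) (A : Set M) :
    K.IsAllowed H X ⟨A, fun a => x a⟩ :=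
  ⟨x, hx, (K.semiOccurs_iff H _ x).2 ⟨1, one_mem H, fun a => by rw [one_smul]⟩⟩

theorem IsStronglyIrreducibleWith.exists_eqOn {κ : ℕ}
    (h : K.IsStronglyIrreducibleWith S H κ X) {A B : Set M} (hA : A.Finite) (hB : B.Finite)
    {x y : M → Q} (hx : x ∈ X) (hy : y ∈ X) (hAB : ∀ a ∈ A, ∀ b ∈ B, ¬ K.dist S a b ≤ κ) :
    ∃ z ∈ X, Set.EqOn z x A ∧ Set.EqOn z y B := by
  obtain ⟨z, hz, hzx, hzy⟩ := h ⟨A, fun a => x a⟩ ⟨B, fun b => y b⟩ hA hB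
    (isAllowed_restriction hx A) (isAllowed_restriction hy B)
    (le_iInf₂ fun a ha => le_iInf₂ fun b hb =>
      Order.add_one_le_of_lt (not_le.1 (hAB a ha b hb)))
  exact ⟨z, hz, fun a ha => (hzx ⟨a, ha⟩).symm, fun b hb => (hzy ⟨b, hb⟩).symm⟩

theorem finite_restrictions [Finite Q] (Y : Set (M → Q)) {A : Set M} (hA : A.Finite) :
    (restrictions Y A).Finite := by
  have := hA.to_subtype
  exact Set.toFinite _

theorem ncard_restrictions_le [Finite Q] (Y : Set (M → Q)) {A B : Set M} (hB : B.Finite)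
    (hAB : A ⊆ B) :
    (restrictions Y B).ncard ≤ (restrictions Y A).ncard * Nat.card Q ^ (B \ A).ncard := by
  have := (hB.subset (Set.sdiff_subset (t := A))).to_subtype
  have hc : (Set.univ : Set (↥(B \ A) → Q)).ncard = Nat.card Q ^ (B \ A).ncard := by
    rw [Set.ncard_univ, Nat.card_fun, Nat.card_coe_set_eq]
  rw [← hc, ← Set.ncard_prod]
  refine Set.ncard_le_ncard_of_injOn
    (fun f => (fun a : A => f ⟨a, hAB a.2⟩, fun b : ↥(B \ A) => f ⟨b, b.2.1⟩)) ?_ ?_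
    ((finite_restrictions Y (hB.subset hAB)).prod Set.finite_univ)
  · rintro _ ⟨y, hy, rfl⟩
    exact ⟨⟨y, hy, rfl⟩, Set.mem_univ _⟩
  · intro f _ g _ hfg
    obtain ⟨h₁, h₂⟩ := Prod.mk.inj hfg
    funext b
    by_cases hb : (b : M) ∈ A
    · exact congrFun h₁ ⟨b, hb⟩
    · exact congrFun h₂ ⟨b, b.2, hb⟩

/-- Each pattern of `Y` on `A` outside the `κ`-neighbourhood of `E` extends to one equal to `w` on
`E`. There are at least `|Y_A| / |Q|^c` such outer patterns, and so at least as many are lost.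
Hypothesis `hY` keeps the extension in `Y`. -/
theorem IsStronglyIrreducibleWith.ncard_restrictions_avoiding [Finite Q] [Nonempty Q] {κ c : ℕ}
    (h : K.IsStronglyIrreducibleWith S H κ X) {A E : Set M} (hA : A.Finite) (hEA : E ⊆ A)
    (hc : (K.nbhd S κ E).ncard ≤ c) (hfin : (K.nbhd S κ E).Finite)
    {Y : Set (M → Q)} (hYX : Y ⊆ X)
    (hY : ∀ y ∈ Y, ∀ z ∈ X, Set.EqOn z y (A \ K.nbhd S κ E) → z ∈ Y) {w : M → Q} (hw : w ∈ X) :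
    Nat.card Q ^ c * (restrictions {y ∈ Y | ¬ Set.EqOn y w E} A).ncard + (restrictions Y A).ncard ≤
      Nat.card Q ^ c * (restrictions Y A).ncard := by
  set Y' : Set (M → Q) := {y ∈ Y | ¬ Set.EqOn y w E} with hY'
  have hsub : restrictions Y' A ⊆ restrictions Y A := Set.image_mono fun y hy => hy.1
  have h₁ := Set.ncard_sdiff_add_ncard_of_subset hsub (finite_restrictions Y hA)
  have h₂ : (restrictions Y (A \ K.nbhd S κ E)).ncard ≤
      (restrictions Y A \ restrictions Y' A).ncard := by
    refine (Set.ncard_le_ncard (t := (fun f : A → Q => fun a : ↥(A \ K.nbhd S κ E) =>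
      f ⟨a, a.2.1⟩) '' (restrictions Y A \ restrictions Y' A)) ?_
      (((finite_restrictions Y hA).sdiff).image _)).trans
      (Set.ncard_image_le (finite_restrictions Y hA).sdiff)
    rintro _ ⟨y, hy, rfl⟩
    obtain ⟨z, hz, hzw, hzy⟩ := h.exists_eqOn (hA.subset hEA) (hA.subset Set.sdiff_subset) hw
      (hYX hy) (B := A \ K.nbhd S κ E) fun a ha b hb hab => hb.2 ⟨a, ha, hab⟩
    refine ⟨A.domRestrict z, ⟨⟨z, hY y hy z hz hzy, rfl⟩, ?_⟩, ?_⟩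
    · rintro ⟨v, hv, hvz⟩
      refine hv.2 fun e he => ?_
      rw [← hzw he]
      exact congrFun hvz ⟨e, hEA he⟩
    · funext a
      exact hzy a.2
  have h₃ : (restrictions Y A).ncard ≤
      (restrictions Y A \ restrictions Y' A).ncard * Nat.card Q ^ c := by
    refine (ncard_restrictions_le Y hA (Set.sdiff_subset (t := K.nbhd S κ E))).trans
      (Nat.mul_le_mul h₂ (Nat.pow_le_pow_right Nat.card_pos (le_trans ?_ hc)))
    exact Set.ncard_le_ncard (fun a ha => by_contra fun h => ha.2 ⟨ha.1, h⟩) hfin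
  calc _ ≤ _ := Nat.add_le_add_left h₃ _
    _ = Nat.card Q ^ c * ((restrictions Y A \ restrictions Y' A).ncard +
        (restrictions Y' A).ncard) := by ring
    _ = _ := by rw [h₁]

theorem IsStronglyIrreducibleWith.ncard_restrictions_avoiding_finset [Finite Q] [Nonempty Q]
    {κ c : ℕ} (h : K.IsStronglyIrreducibleWith S H κ X) {A : Set M} (hA : A.Finite) {ι : Type*}
    (E : ι → Set M) (w : ι → M → Q) (T : Finset ι) (hEA : ∀ t ∈ T, E t ⊆ A)
    (hc : ∀ t ∈ T, (K.nbhd S κ (E t)).ncard ≤ c) (hfin : ∀ t ∈ T, (K.nbhd S κ (E t)).Finite)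
    (hdisj : ∀ t ∈ T, ∀ t' ∈ T, t ≠ t' → Disjoint (E t) (K.nbhd S κ (E t')))
    (hw : ∀ t ∈ T, w t ∈ X) :
    (Nat.card Q ^ c) ^ T.card *
        (restrictions {x ∈ X | ∀ t ∈ T, ¬ Set.EqOn x (w t) (E t)} A).ncard ≤
      (Nat.card Q ^ c - 1) ^ T.card * (restrictions X A).ncard := by
  classical
  induction T using Finset.induction_on with
  | empty => simp
  | insert i T hi ih =>
    have hT : ∀ t ∈ T, t ∈ insert i T := fun t ht => Finset.mem_insert_of_mem ht
    have hiT : i ∈ insert i T := Finset.mem_insert_self i T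
    specialize ih (fun t ht => hEA t (hT t ht)) (fun t ht => hc t (hT t ht))
      (fun t ht => hfin t (hT t ht)) (fun t ht t' ht' => hdisj t (hT t ht) t' (hT t' ht'))
      (fun t ht => hw t (hT t ht))
    set Y : Set (M → Q) := {x ∈ X | ∀ t ∈ T, ¬ Set.EqOn x (w t) (E t)} with hYdef
    have hset : {x ∈ X | ∀ t ∈ insert i T, ¬ Set.EqOn x (w t) (E t)} =
        {y ∈ Y | ¬ Set.EqOn y (w i) (E i)} := by
      ext x
      simp only [hYdef, Set.mem_ofPred_eq, Finset.forall_mem_insert]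
      tauto
    have hstep := h.ncard_restrictions_avoiding hA (hEA i hiT) (hc i hiT) (hfin i hiT)
      (Y := Y) (fun y hy => hy.1) (fun y hy z hz hzy => ⟨hz, fun t ht hzw =>
        hy.2 t ht fun e he => ?_⟩) (hw i hiT)
    · rw [hset, Finset.card_insert_of_notMem hi, pow_succ, pow_succ]
      set C := Nat.card Q ^ c
      have hC : 0 < C := pow_pos Nat.card_pos c
      obtain ⟨D, hD⟩ : ∃ D, C = D + 1 := ⟨C - 1, by omega⟩
      have hstep' : C * (restrictions {y ∈ Y | ¬ Set.EqOn y (w i) (E i)} A).ncard ≤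
          (C - 1) * (restrictions Y A).ncard := by
        rw [hD] at hstep ⊢
        rw [Nat.add_sub_cancel]
        linarith
      calc _ = C ^ T.card * (C * (restrictions {y ∈ Y | ¬ Set.EqOn y (w i) (E i)} A).ncard) := by
            ring
        _ ≤ C ^ T.card * ((C - 1) * (restrictions Y A).ncard) := by gcongr
        _ = (C - 1) * (C ^ T.card * (restrictions Y A).ncard) := by ring
        _ ≤ (C - 1) * ((C - 1) ^ T.card * (restrictions X A).ncard) := by gcongr
        _ = _ := by ring
    -- The earlier tiles miss the `κ`-neighbourhood of tile `i`, so rewriting there leaves their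
    -- constraints intact.
    · rw [← hzy ⟨hEA t (hT t ht) he, ?_⟩, hzw he]
      have hti : t ≠ i := fun h => hi (h ▸ ht)
      exact Set.disjoint_left.1 (hdisj t (hT t ht) i hiT hti) he

/-- If `(1 - 1/C)^k < 1/(q + 1)`, then `k` tiles pay for one extra free cell. Positivity of `t`
gives strictness when `a = 0`. -/
theorem exists_pow_mul_pow_lt {C q : ℕ} (hC : 0 < C) :
    ∃ k : ℕ, ∀ t a : ℕ, 0 < t → k * a ≤ t → (C - 1) ^ t * q ^ a < C ^ t := by
  obtain ⟨k, hk⟩ : ∃ k, (C - 1) ^ k * q < C ^ k := by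
    have hC' : (0 : ℝ) < C := by exact_mod_cast hC
    obtain ⟨k, hk⟩ := exists_pow_lt_of_lt_one (x := (1 : ℝ) / (q + 1)) (y := ((C - 1 : ℕ) : ℝ) / C)
      (by positivity) (by rw [div_lt_one hC']; exact_mod_cast Nat.sub_lt hC one_pos)
    refine ⟨k, ?_⟩
    rw [div_pow, div_lt_div_iff₀ (by positivity) (by positivity), one_mul] at hk
    have : (C - 1) ^ k * (q + 1) < C ^ k := by exact_mod_cast hk
    exact lt_of_le_of_lt (Nat.mul_le_mul_left _ q.le_succ) this
  refine ⟨k, fun t a ht hta => ?_⟩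
  rcases Nat.eq_zero_or_pos a with rfl | ha
  · simpa using Nat.pow_lt_pow_left (Nat.sub_lt hC one_pos) ht.ne'
  · obtain ⟨d, rfl⟩ := Nat.exists_eq_add_of_le hta
    calc (C - 1) ^ (k * a + d) * q ^ a = ((C - 1) ^ k * q) ^ a * (C - 1) ^ d := by
          rw [pow_add, pow_mul, mul_pow]; ring
      _ ≤ ((C - 1) ^ k * q) ^ a * C ^ d := by gcongr; omega
      _ < (C ^ k) ^ a * C ^ d := by
          gcongr
      _ = _ := by rw [← pow_mul, pow_add]

theorem exists_separated_covering {F : Set M} (hF : F.Finite) (r : ℕ) :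
    ∃ T : Finset M, (T : Set M) ⊆ F ∧
      (∀ t ∈ T, ∀ t' ∈ T, t ≠ t' → ¬ K.dist S t t' ≤ r) ∧
      ∀ m ∈ F, ∃ t ∈ T, K.dist S t m ≤ r := by
  classical
  -- A maximal separated subset covers, since an uncovered cell could be added.
  obtain ⟨T, hT⟩ := ((hF.toFinset.powerset.finite_toSet).subset
    (Set.sep_subset _ fun T => ∀ t ∈ T, ∀ t' ∈ T, t ≠ t' → ¬ K.dist S t t' ≤ r)).exists_maximal
    ⟨∅, by simp⟩
  have hTF : (T : Set M) ⊆ F := by simpa using hT.prop.1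
  refine ⟨T, hTF, hT.prop.2, fun m hm => ?_⟩
  by_contra! hcon
  have hmT : m ∉ T := fun h => (hcon m h).not_ge ((dist_self m).trans_le zero_le)
  refine hmT (hT.le_of_ge (y := insert m T) ⟨?_, ?_⟩ (Finset.subset_insert m T)
    (Finset.mem_insert_self m T))
  · simpa [Set.insert_subset_iff] using ⟨hm, hTF⟩
  · intro t ht t' ht' hne
    rw [Finset.mem_insert] at ht ht'
    rcases ht with rfl | ht <;> rcases ht' with rfl | ht'
    · exact absurd rfl hne
    · rw [dist_comm]; exact (hcon t' ht').not_ge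
    · exact (hcon t ht).not_ge
    · exact hT.prop.2 t ht t' ht' hne

/-- The point `c` translated by `g`. -/
def translatePoint (g : G) (c : M → Q) : M → Q := fun m => c (g⁻¹ • m)

theorem IsSubshift.translatePoint_mem (hX : K.IsSubshift H X) {g : G} (hg : g ∈ H) {x : M → Q}
    (hx : x ∈ X) : translatePoint g x ∈ X := hX.shift_mem (inv_mem hg) hx

theorem exists_ncard_restrictions_avoiding_lt [Finite Q] (hfin : S.Finite)
    (hS : K.IsRightGenerating S) (hsymm : K.IsSymmetric S) (hH : K.IsBig H)
    (hamen : K.IsRightAmenable) (hX : K.IsSubshift H X) (hirr : K.IsStronglyIrreducible S H X)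
    {E : Set M} (hE : E.Finite) {y : M → Q} (hy : y ∈ X) (ρ : ℕ) :
    ∃ (F A : Set M) (T : Finset M), F.Finite ∧ A.Finite ∧ K.nbhd S ρ F ⊆ A ∧
      (∀ t ∈ T, ∀ t' ∈ T, t ≠ t' → Disjoint (K.coord t • E) (K.coord t' • E)) ∧
      (restrictions {x ∈ X | ∀ t ∈ T, ¬ Set.EqOn x (translatePoint (K.coord t) y)
        (K.coord t • E)} A).ncard < (restrictions X F).ncard := by
  obtain ⟨κ, hirr⟩ := hirr
  have : Nonempty Q := ⟨y K.origin⟩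
  obtain ⟨R₀, hR₀⟩ := exists_subset_ball hS hsymm hE
  set R := R₀ + κ with hR
  set c := (K.nbhd S κ E).ncard with hcdef
  set b := (K.ball S (R + R)).ncard with hb
  obtain ⟨k, hk⟩ := exists_pow_mul_pow_lt (C := Nat.card Q ^ c) (q := Nat.card Q)
    (pow_pos Nat.card_pos c)
  -- Balls of radius `R + R` around `T` will cover `F`, so `|F| ≤ b |T|`. The Følner constant `b *
  -- k` then leaves `k |A \ F| ≤ |T|`.
  obtain ⟨F, hF, hFne, hFol⟩ := exists_folner hfin hS hsymm hamen (ρ + R) (b * k)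
  have hA := finite_nbhd hfin hS hsymm (ρ + R) hF
  set A := K.nbhd S (ρ + R) F
  obtain ⟨T, hTF, hsep, hcov⟩ := exists_separated_covering (K := K) (S := S) hF (R + R)
  have hbpos : 0 < b := (Set.ncard_pos (finite_setOf_dist_le hfin hS hsymm _ _)).2
    ⟨K.origin, (dist_self _).trans_le zero_le⟩
  have hFT : F.ncard ≤ T.card * b := by
    classical
    calc F.ncard ≤ (T.biUnion fun t =>
          (finite_setOf_dist_le hfin hS hsymm (R + R) t).toFinset : Set M).ncard := by
          refine Set.ncard_le_ncard (fun m hm => ?_) (Finset.finite_toSet _)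
          simpa using hcov m hm
      _ ≤ T.card * b := by
          rw [Set.ncard_coe_finset]
          refine Finset.card_biUnion_le_card_mul _ _ _ fun t _ => ?_
          rw [← Set.ncard_eq_toFinset_card _ (finite_setOf_dist_le hfin hS hsymm (R + R) t),
            ncard_setOf_dist_le hS]
  have hkT : k * (A \ F).ncard ≤ T.card := by
    refine Nat.le_of_mul_le_mul_left ?_ hbpos
    linarith
  have hTpos : 0 < T.card := by
    obtain ⟨m, hm⟩ := hFne
    obtain ⟨t, ht, -⟩ := hcov m hm
    exact Finset.card_pos.2 ⟨t, ht⟩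
  have htile : ∀ t, ∀ m ∈ K.coord t • E, K.dist S t m ≤ R₀ := by
    rintro t _ ⟨e, he, rfl⟩
    exact dist_coord_smul_le hS t (hR₀ he)
  have htile' : ∀ t, ∀ m ∈ K.nbhd S κ (K.coord t • E), K.dist S t m ≤ R := by
    rintro t m ⟨a, ha, hm⟩
    exact dist_le_add (htile t a ha) hm
  have hdisj : ∀ t ∈ T, ∀ t' ∈ T, t ≠ t' →
      Disjoint (K.coord t • E) (K.nbhd S κ (K.coord t' • E)) := by
    intro t ht t' ht' hne
    rw [Set.disjoint_left]
    intro m hm hm'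
    have h₁ := htile t m hm
    have h₂ := htile' t' m hm'
    rw [dist_comm] at h₂
    exact hsep t ht t' ht' hne ((dist_le_add h₁ h₂).trans (by exact_mod_cast (by omega)))
  refine ⟨F, A, T, hF, hA, nbhd_mono (by omega) subset_rfl,
    fun t ht t' ht' hne => (hdisj t ht t' ht' hne).mono_right (subset_nbhd _ _), ?_⟩
  have h₁ := hirr.ncard_restrictions_avoiding_finset hA (fun t => K.coord t • E)
    (fun t => translatePoint (K.coord t) y) T (c := c)
    (fun t ht m hm => ⟨t, hTF ht, (htile t m hm).trans (by exact_mod_cast (by omega))⟩)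
    (fun t _ => by
      rw [nbhd_smul hS]
      exact Set.ncard_image_le (finite_nbhd hfin hS hsymm κ hE))
    (fun t _ => finite_nbhd hfin hS hsymm κ (hE.image _)) hdisj
    (fun t _ => hX.translatePoint_mem (hH t) hy)
  have h₂ := ncard_restrictions_le X hA (subset_nbhd (K := K) (S := S) (ρ + R) F)
  have h₃ := hk T.card (A \ F).ncard hTpos hkT
  have h₄ : 0 < (restrictions X F).ncard :=
    (Set.ncard_pos (finite_restrictions X hF)).2 ⟨_, y, hy, rfl⟩
  refine Nat.lt_of_mul_lt_mul_left (a := (Nat.card Q ^ c) ^ T.card) ?_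
  calc _ ≤ _ := h₁
    _ ≤ (Nat.card Q ^ c - 1) ^ T.card *
        ((restrictions X F).ncard * Nat.card Q ^ (A \ F).ncard) := Nat.mul_le_mul_left _ h₂
    _ = ((Nat.card Q ^ c - 1) ^ T.card * Nat.card Q ^ (A \ F).ncard) *
        (restrictions X F).ncard := by ring
    _ < _ := Nat.mul_lt_mul_of_pos_right h₃ h₄

/-! ### Gluing points of subshifts of finite type -/

/-- The finitely many forbidden blocks lie in one ball of radius `r`. A translate of a block that
meets `A` stays in the `2r`-neighbourhood of `A`, where the glued point equals `x`; any other
translate sees only `y`. -/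
theorem IsOfFiniteType.exists_piecewise_mem (hS : K.IsRightGenerating S)
    (hsymm : K.IsSymmetric S) (hX : K.IsOfFiniteType H X) :
    ∃ s : ℕ, ∀ (A : Set M) [DecidablePred (· ∈ A)] (x y : M → Q), x ∈ X → y ∈ X →
      (∀ m ∈ K.nbhd S s A, m ∉ A → x m = y m) → A.piecewise x y ∈ X := by
  obtain ⟨F, hF, hblock, rfl⟩ := hX
  obtain ⟨r, hr⟩ := exists_subset_ball (K := K) (S := S) hS hsymm
    (hF.biUnion fun f hf => hblock f hf)
  refine ⟨r + r, fun A _ x y hx hy hxy f hf hocc => ?_⟩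
  obtain ⟨h, hh, hval⟩ := (K.semiOccurs_iff H f _).1 hocc
  by_cases hmeet : ∃ a : f.dom, h • (a : M) ∈ A
  · obtain ⟨a, ha⟩ := hmeet
    refine hx f hf ((K.semiOccurs_iff H f x).2 ⟨h, hh, fun b => ?_⟩)
    rw [hval b]
    by_cases hb : h • (b : M) ∈ A
    · rw [Set.piecewise_eq_of_mem _ _ _ hb]
    · rw [Set.piecewise_eq_of_notMem _ _ _ hb]
      refine (hxy _ ⟨_, ha, ?_⟩ hb).symm
      rw [dist_smul hS]
      have h₁ : K.dist S K.origin a ≤ r := hr (Set.mem_biUnion hf a.2)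
      have h₂ : K.dist S K.origin b ≤ r := hr (Set.mem_biUnion hf b.2)
      rw [dist_comm] at h₁
      exact dist_le_add h₁ h₂
  · push Not at hmeet
    refine hy f hf ((K.semiOccurs_iff H f y).2 ⟨h, hh, fun b => ?_⟩)
    rw [hval b, Set.piecewise_eq_of_notMem _ _ _ (hmeet b)]

/-! ### Local maps -/

theorem IsLocal.exists_determined (hS : K.IsRightGenerating S) {Y : Set (M → Q)} {Δ : X → Y}
    (hΔ : K.IsLocal S H Δ) :
    ∃ r : ℕ, ∀ (x x' : X) (m : M),
      (∀ n, K.dist S m n ≤ r → (x : M → Q) n = (x' : M → Q) n) →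
        (Δ x : M → Q) m = (Δ x' : M → Q) m := by
  obtain ⟨r, N, hN, hN₀, δ, -, hδ⟩ := hΔ
  refine ⟨r, fun x x' m hxx' => ?_⟩
  obtain ⟨p, hp, hpm⟩ := hδ x m
  obtain ⟨p', hp', hpm'⟩ := hδ x' m
  rw [hpm, hpm']
  congr 1
  refine Subtype.ext ?_
  rw [hp, hp']
  funext n
  refine hxx' _ ?_
  rw [semiAct_toQuotient]
  exact dist_coord_smul_le hS m (hN n.2)

/-- Translation by `g` carries the view from `g⁻¹ • m` to the view from `m` up to an element `k` of
`H₀`, which `δ` ignores. -/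
theorem IsLocal.translatePoint_apply (hH : K.IsBig H) {Y : Set (M → Q)} {Δ : X → Y}
    (hΔ : K.IsLocal S H Δ) {g : G} (hg : g ∈ H) {x x' : X}
    (hx : (x' : M → Q) = translatePoint g x) :
    (Δ x' : M → Q) = translatePoint g (Δ x) := by
  obtain ⟨r, N, -, hN, δ, hinv, hδ⟩ := hΔ
  funext m
  obtain ⟨p, hp, hpm⟩ := hδ x (g⁻¹ • m)
  obtain ⟨p', hp', hpm'⟩ := hδ x' m
  rw [translatePoint, hpm, hpm']
  set k : G := (K.coord m)⁻¹ * g * K.coord (g⁻¹ • m) with hk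
  have hkH : k ∈ H := mul_mem (mul_mem (inv_mem (hH m)) hg) (hH _)
  have hks : k ∈ K.stab := by
    rw [MulAction.mem_stabilizer_iff, hk, mul_smul, mul_smul, K.coord_smul, smul_inv_smul,
      inv_smul_eq_iff, K.coord_smul]
  refine hinv ⟨k, hks⟩ hkH p p' ?_
  rw [hp, hp', hx]
  funext n
  simp only [rotate, translatePoint, semiAct_toQuotient, ← mul_smul]
  rw [hk]
  group

theorem IsLocal.exists_translatePoint (hH : K.IsBig H) (hX : K.IsSubshift H X) {Δ : X → X}
    (hΔ : K.IsLocal S H Δ) {g : G} (hg : g ∈ H) (x : X) :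
    ∃ x' : X, (x' : M → Q) = translatePoint g x ∧ (Δ x' : M → Q) = translatePoint g (Δ x) :=
  ⟨⟨_, hX.translatePoint_mem hg x.2⟩, rfl, hΔ.translatePoint_apply hH hg rfl⟩

/-! ### Compactness -/

theorem IsSubshift.isClosed [TopologicalSpace Q] [DiscreteTopology Q] (hX : K.IsSubshift H X) :
    IsClosed X := by
  obtain ⟨F, hF, rfl⟩ := hX
  have hset : K.generated H F = ⋂ f ∈ F, ⋂ h ∈ H,
      {c : M → Q | ∀ a : f.dom, c (h • (a : M)) = f.val a}ᶜ := by
    ext c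
    simp only [generated, semiOccurs_iff, Set.mem_ofPred_eq, Set.mem_iInter, Set.mem_compl_iff]
    refine forall₂_congr fun f _ => ?_
    simp only [not_exists, not_and, eq_comm]
  rw [hset]
  refine isClosed_biInter fun f hf => isClosed_biInter fun h _ => ?_
  rw [isClosed_compl_iff, Set.ofPred_forall]
  have := (hF f hf).to_subtype
  exact isOpen_iInter_of_finite fun a =>
    isOpen_discrete ({f.val a} : Set Q) |>.preimage
      (f := fun c : M → Q => c (h • (a : M))) (continuous_apply _)

theorem IsLocal.continuous [TopologicalSpace Q] [DiscreteTopology Q] (hfin : S.Finite)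
    (hS : K.IsRightGenerating S) (hsymm : K.IsSymmetric S) {Δ : X → X} (hΔ : K.IsLocal S H Δ) :
    Continuous Δ := by
  obtain ⟨r, hr⟩ := hΔ.exists_determined hS
  refine Continuous.subtype_mk (f := fun x => (Δ x : M → Q)) (continuous_pi fun m => ?_) _
  refine (IsLocallyConstant.iff_exists_open _).2 (fun x => ?_) |>.continuous
  have hB := finite_setOf_dist_le hfin hS hsymm r m
  refine ⟨⋂ n ∈ {n | K.dist S m n ≤ r}, {x' : X | (x' : M → Q) n = (x : M → Q) n},
    hB.isOpen_biInter fun n _ => ?_, ?_, ?_⟩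
  · exact (isOpen_discrete ({(x : M → Q) n} : Set Q)).preimage
      (f := fun x' : X => (x' : M → Q) n) ((continuous_apply n).comp continuous_subtype_val)
  · simp
  · intro x' hx'
    exact hr x' x m fun n hn => Set.mem_iInter₂.1 hx' n hn

/-- The image of the compact set `X` is closed, so a cylinder around `y` misses it. -/
theorem IsLocal.exists_finite_not_eqOn [Finite Q] (hfin : S.Finite) (hS : K.IsRightGenerating S)
    (hsymm : K.IsSymmetric S) (hX : K.IsSubshift H X) {Δ : X → X} (hΔ : K.IsLocal S H Δ) {y : X}
    (hy : y ∉ Set.range Δ) :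
    ∃ E : Set M, E.Finite ∧ ∀ x : X, ¬ Set.EqOn (Δ x : M → Q) y E := by
  let _ : TopologicalSpace Q := ⊥
  have : DiscreteTopology Q := ⟨rfl⟩
  have : CompactSpace X := isCompact_iff_compactSpace.1 hX.isClosed.isCompact
  have hclosed : IsClosed (Set.range fun x => (Δ x : M → Q)) :=
    (isCompact_range (continuous_subtype_val.comp (hΔ.continuous hfin hS hsymm))).isClosed
  have hy' : (y : M → Q) ∈ (Set.range fun x => (Δ x : M → Q))ᶜ := by
    rintro ⟨x, hx⟩
    exact hy ⟨x, Subtype.ext hx⟩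
  obtain ⟨I, u, hu, hsub⟩ := isOpen_pi_iff.1 hclosed.isOpen_compl _ hy'
  refine ⟨I, I.finite_toSet, fun x hx => hsub (fun m hm => ?_) ⟨x, rfl⟩⟩
  change (Δ x : M → Q) m ∈ u m
  rw [hx hm]
  exact (hu m hm).2

/-! ### The Garden of Eden theorem -/

theorem hasMyhillProperty [Finite Q] (hfin : S.Finite)
    (hS : K.IsRightGenerating S) (hsymm : K.IsSymmetric S) (hH : K.IsBig H)
    (hamen : K.IsRightAmenable) (hX : K.IsSubshift H X) (hirr : K.IsStronglyIrreducible S H X)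
    (hft : K.IsOfFiniteType H X) : K.HasMyhillProperty S H X := by
  classical
  intro Δ hΔ hpre y
  by_contra hy
  obtain ⟨E, hE, hEy⟩ := hΔ.exists_finite_not_eqOn hfin hS hsymm hX hy
  obtain ⟨r, hr⟩ := hΔ.exists_determined hS
  obtain ⟨s, hs⟩ := hft.exists_piecewise_mem hS hsymm
  obtain ⟨κ, hκ⟩ := id hirr
  obtain ⟨F, A, T, hF, hA, hFA, -, hlt⟩ :=
    exists_ncard_restrictions_avoiding_lt hfin hS hsymm hH hamen hX hirr hE y.2 (κ + r)
  have hext : ∀ p ∈ restrictions X F, ∃ z : X, F.domRestrict (z : M → Q) = p ∧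
      ∀ m ∉ K.nbhd S κ F, (z : M → Q) m = (y : M → Q) m := by
    rintro _ ⟨x, hx, rfl⟩
    have hN := finite_nbhd hfin hS hsymm κ hF
    -- Strong irreducibility concerns blocks only, so `y` is matched just on the finite `s`-collar
    -- of `K.nbhd S κ F`. Gluing then supplies `y` on everything outside that neighbourhood.
    obtain ⟨z, hz, hzx, hzy⟩ := hκ.exists_eqOn hF
      ((finite_nbhd hfin hS hsymm s hN).subset (Set.sdiff_subset (t := K.nbhd S κ F))) hx y.2
      fun a ha b hb hab => hb.2 ⟨a, ha, hab⟩
    refine ⟨⟨_, hs (K.nbhd S κ F) z y hz y.2 fun m hm hm' => hzy ⟨hm, hm'⟩⟩, ?_, ?_⟩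
    · funext a
      exact (Set.piecewise_eq_of_mem _ _ _ (subset_nbhd κ F a.2)).trans (hzx a.2)
    · intro m hm
      exact Set.piecewise_eq_of_notMem _ _ _ hm
  have : Nonempty X := ⟨y⟩
  choose! z hzp hzy using hext
  refine hlt.not_ge (Set.ncard_le_ncard_of_injOn (fun p => A.domRestrict (Δ (z p) : M → Q))
    (fun p hp => ⟨_, ⟨(Δ (z p)).2, ?_⟩, rfl⟩) ?_ (finite_restrictions _ hA))
  · intro t ht h
    obtain ⟨x', -, hx'⟩ := hΔ.exists_translatePoint hH hX (inv_mem (hH t)) (z p)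
    refine hEy x' fun e he => ?_
    have := h (Set.smul_mem_smul_set (a := K.coord t) he)
    rw [hx']
    simpa [translatePoint] using this
  · intro p hp q hq hpq
    have hzz : ∀ m ∉ K.nbhd S κ F, (z p : M → Q) m = (z q : M → Q) m := fun m hm => by
      rw [hzy p hp m hm, hzy q hq m hm]
    have hΔz : Δ (z p) = Δ (z q) := by
      refine Subtype.ext (funext fun m => ?_)
      by_cases hm : m ∈ A
      · exact congrFun hpq ⟨m, hm⟩
      -- Outside `A` the window of radius `r` misses `K.nbhd S κ F`, and both points equal `y` on
      -- it. This is why the margin is `κ + r`.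
      · refine hr _ _ m fun n hn => hzz n fun hnF => hm (hFA (nbhd_nbhd_subset _ _ _ ⟨n, hnF, ?_⟩))
        rwa [dist_comm]
    have := hpre _ _ ((finite_nbhd hfin hS hsymm κ hF).subset fun m hm =>
      by_contra fun h => hm (hzz m h)) hΔz
    rw [← hzp p hp, ← hzp q hq, this]

/-- Mutually erasable points allow the removal of the occurrences of one of them at any finite
set of disjoint positions, without altering the image. -/
theorem exists_avoiding_of_eq {Δ : X → X} {r s : ℕ} (hS : K.IsRightGenerating S)
    (hH : K.IsBig H) (hX : K.IsSubshift H X) (hΔ : K.IsLocal S H Δ)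
    (hr : ∀ (x x' : X) (m : M), (∀ n, K.dist S m n ≤ r → (x : M → Q) n = (x' : M → Q) n) →
      (Δ x : M → Q) m = (Δ x' : M → Q) m)
    (hs : ∀ (A : Set M) [DecidablePred (· ∈ A)] (x y : M → Q), x ∈ X → y ∈ X →
      (∀ m ∈ K.nbhd S s A, m ∉ A → x m = y m) → A.piecewise x y ∈ X)
    {x x' : X} (hxx' : x ≠ x') (heq : Δ x = Δ x') (T : Finset M)
    (hT : ∀ t ∈ T, ∀ t' ∈ T, t ≠ t' → Disjoint
      (K.coord t • K.nbhd S (s + (r + r)) (difference (x : M → Q) x'))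
      (K.coord t' • K.nbhd S (s + (r + r)) (difference (x : M → Q) x'))) (y : X) :
    ∃ z : X, Δ z = Δ y ∧
      ∀ t ∈ T, ¬ Set.EqOn (z : M → Q) (translatePoint (K.coord t) x)
        (K.coord t • K.nbhd S (s + (r + r)) (difference (x : M → Q) x')) := by
  classical
  set D := difference (x : M → Q) x' with hD
  set E := K.nbhd S (s + (r + r)) D with hE
  have hDE : D ⊆ E := subset_nbhd _ _
  induction T using Finset.induction_on with
  | empty => exact ⟨y, rfl, by simp⟩
  | insert i T hi ih =>
    obtain ⟨z, hzy, hzT⟩ := ih fun t ht t' ht' =>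
      hT t (Finset.mem_insert_of_mem ht) t' (Finset.mem_insert_of_mem ht')
    by_cases hzi : Set.EqOn (z : M → Q) (translatePoint (K.coord i) x) (K.coord i • E)
    swap
    · refine ⟨z, hzy, ?_⟩
      rw [Finset.forall_mem_insert]
      exact ⟨hzi, hzT⟩
    set g := K.coord i with hg
    obtain ⟨u, hu, hΔu⟩ := hΔ.exists_translatePoint hH hX (hH i) x
    obtain ⟨u', hu', hΔu'⟩ := hΔ.exists_translatePoint hH hX (hH i) x'
    have huu' : ∀ m ∉ g • D, (u : M → Q) m = (u' : M → Q) m := by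
      intro m hm
      rw [Set.mem_smul_set_iff_inv_smul_mem] at hm
      rw [hu, hu']
      exact not_not.1 hm
    have hgE : g • E = K.nbhd S (s + (r + r)) (g • D) := (nbhd_smul hS _ _ _).symm
    have hzu : ∀ m ∈ g • E, (z : M → Q) m = (u : M → Q) m := fun m hm => by rw [hzi hm, hu]
    -- The copy `u` of `x` in `z` is replaced by the copy `u'` of `x'`. On the `s`-collar of `g • D`
    -- both `z` and `u'` equal `u`, so the result lies in `X`.
    let v : X := ⟨(g • D).piecewise u' z, hs _ _ _ u'.2 z.2 fun m hm hm' => by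
      rw [hzu m (hgE ▸ nbhd_mono (by omega) subset_rfl hm), huu' m hm']⟩
    have hvz : ∀ m ∉ g • D, (v : M → Q) m = (z : M → Q) m := fun m hm =>
      Set.piecewise_eq_of_notMem _ _ _ hm
    have hvu' : ∀ m ∈ g • E, (v : M → Q) m = (u' : M → Q) m := by
      intro m hm
      by_cases hmD : m ∈ g • D
      · exact Set.piecewise_eq_of_mem _ _ _ hmD
      · rw [hvz m hmD, hzu m hm, huu' m hmD]
    refine ⟨v, ?_, ?_⟩
    · rw [← hzy]
      refine Subtype.ext (funext fun m => ?_)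
      -- Near `g • D` the window lies within distance `r + r` of it, inside `g • E`, where `v` is
      -- `u'` and `z` is `u`. Elsewhere the window misses `g • D`, where alone `v` and `z` can
      -- differ.
      by_cases hm : m ∈ K.nbhd S r (g • D)
      · have hball : ∀ n, K.dist S m n ≤ r → n ∈ g • E := fun n hn => by
          rw [hgE]
          exact nbhd_mono (by omega) subset_rfl (nbhd_nbhd_subset r r _ ⟨m, hm, hn⟩)
        rw [hr v u' m fun n hn => hvu' n (hball n hn), hr z u m fun n hn => hzu n (hball n hn),
          hΔu, hΔu', heq]
      · refine hr v z m fun n hn => hvz n fun hnD => hm ⟨n, hnD, ?_⟩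
        rwa [dist_comm]
    · rw [Finset.forall_mem_insert]
      constructor
      · intro hv
        obtain ⟨d, hd⟩ : ∃ d, (x : M → Q) d ≠ (x' : M → Q) d :=
          Function.ne_iff.1 fun h => hxx' (Subtype.ext h)
        have hgd : g • d ∈ g • E := Set.smul_mem_smul_set (hDE hd)
        have h₁ := hv hgd
        rw [hvu' _ hgd, hu'] at h₁
        refine hd ?_
        simpa only [translatePoint, hg, inv_smul_smul] using h₁.symm
      · intro t ht hv
        refine hzT t ht fun m hm => ?_
        rw [← hv hm, hvz]
        intro hmD
        have hit : i ≠ t := fun h => hi (h ▸ ht)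
        exact Set.disjoint_left.1 (hT i (Finset.mem_insert_self i T) t
          (Finset.mem_insert_of_mem ht) hit) (Set.smul_set_mono hDE hmD) hm

theorem hasMooreProperty [Finite Q] (hfin : S.Finite)
    (hS : K.IsRightGenerating S) (hsymm : K.IsSymmetric S) (hH : K.IsBig H)
    (hamen : K.IsRightAmenable) (hX : K.IsSubshift H X) (hirr : K.IsStronglyIrreducible S H X)
    (hft : K.IsOfFiniteType H X) : K.HasMooreProperty S H X := by
  intro Δ hΔ hsurj x x' hD heq
  by_contra hne
  obtain ⟨r, hr⟩ := hΔ.exists_determined hS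
  obtain ⟨s, hs⟩ := hft.exists_piecewise_mem hS hsymm
  obtain ⟨F, A, T, hF, hA, hFA, hdisj, hlt⟩ :=
    exists_ncard_restrictions_avoiding_lt hfin hS hsymm hH hamen hX hirr
      (finite_nbhd hfin hS hsymm (s + (r + r)) hD) x.2 r
  have hpre : ∀ p ∈ restrictions X F, ∃ z : X, F.domRestrict (Δ z : M → Q) = p ∧
      ∀ t ∈ T, ¬ Set.EqOn (z : M → Q) (translatePoint (K.coord t) x)
        (K.coord t • K.nbhd S (s + (r + r)) (difference (x : M → Q) x')) := by
    rintro _ ⟨w, hw, rfl⟩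
    obtain ⟨y, hy⟩ := hsurj ⟨w, hw⟩
    obtain ⟨z, hzy, hz⟩ := exists_avoiding_of_eq hS hH hX hΔ hr hs hne heq T hdisj y
    exact ⟨z, by rw [hzy, hy], hz⟩
  have : Nonempty X := ⟨x⟩
  choose! z hzp hzT using hpre
  refine hlt.not_ge (Set.ncard_le_ncard_of_injOn (fun p => A.domRestrict (z p : M → Q))
    (fun p hp => ⟨_, ⟨(z p).2, hzT p hp⟩, rfl⟩) ?_ (finite_restrictions _ hA))
  intro p hp q hq hpq
  rw [← hzp p hp, ← hzp q hq]
  funext a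
  -- The image on `F` depends only on the `r`-neighbourhood of `F`, which `A` contains.
  exact hr _ _ a fun n hn => congrFun hpq ⟨n, hFA ⟨a, a.2, hn⟩⟩

end CoordinateSystem

theorem mainTheorem2 {G M Q : Type*} [Group G] [MulAction G M] [Finite Q]
    (K : CoordinateSystem G M) (hstab : Finite K.stab)
    (S : Set (G ⧸ K.stab)) (hSfin : S.Finite) (hSsymm : K.IsSymmetric S)
    (hSgen : K.IsRightGenerating S)
    (H : Subgroup G) (hH : K.IsBig H)
    (hamen : K.IsRightAmenable)
    (X : Set (M → Q)) (hX : K.IsSubshift H X) (hXirr : K.IsStronglyIrreducible S H X)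
    (hXft : K.IsOfFiniteType H X) :
    K.HasMooreProperty S H X ∧ K.HasMyhillProperty S H X :=
  ⟨CoordinateSystem.hasMooreProperty hSfin hSgen hSsymm hH hamen hX hXirr hXft,
    CoordinateSystem.hasMyhillProperty hSfin hSgen hSsymm hH hamen hX hXirr hXft⟩
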